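/- Let $d,r\ge 1$ be integers. For an invertible $S\in\mathbb R^{d\times d}$, $v\in\mathbb R^d$ and a continuous function $f:\mathbb R^d\to\mathbb R$ with compact support put $$Q_S^v(f)=\frac1{|\det S|}\sum_{m\in\mathbb Z^d} f\big(S^{-\top}(m+v)\big),\qquad I_d(f)=\int_{\mathbb R^d} f(x)\,dx .$$ Let $B\in\mathbb R^{d\times d}$ be a Frolov matrix, that is: (a) $B$ is invertible; (b) $\big|\prod_{j=1}^d (Bm)_j\big|\ge 1$ for all $m\in\mathbb Z^d\setminus\{0\}$; (c) for all $x,y\in\mathbb R^d$ the box of all $z$ with $z_j$ between $x_j$ and $y_j$ for each $j$ contains at most $\prod_{j=1}^d|x_j-y_j|+1$ of the points $Bm$, $m\in\mathbb Z^d$. Let $H^{r,\mathrm{mix}}(\mathbb R^d)$ be the space of all $f\in L^2(\mathbb R^d)$ (real valued) whose weak derivatives $D^\alpha f$ exist and belong to $L^2(\mathbb R^d)$ for every $\alpha\in\{0,\dots,r\}^d$; its elements are identified with their continuous representatives. Let $\mathring H^{r,\mathrm{mix}}([0,1]^d)$ be the space of those $f\in H^{r,\mathrm{mix}}(\mathbb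 R^d)$ whose support is contained in $[0,1]^d$, with $$\|f\|_{H^{r,\mathrm{mix}}([0,1]^d)}=\Big(\sum_{\alpha\in\{0,\dots,r\}^d}\|D^\alpha f\|_{L^2([0,1]^d)}^2\Big)^{1/2}.$$ Then there is a constant $c>0$, depending only on $d$, $r$ and $B$, such that the following holds. Let $U$ and $V$ be independent random vectors, uniformly distributed in $[1,2^{1/d}]^d$ and $[0,1]^d$ respectively, and write $\hat U=\mathrm{diag}(U_1,\dots,U_d)$. For every integer $n\ge 2$ and every $f\in\mathring H^{r,\mathrm{mix}}([0,1]^d)$, the error $Q^V_{n^{1/d}\hat U B}(f)-I_d(f)$ is square-integrable and $$\Big(\mathbb E\,\big|Q^V_{n^{1/d}\hat U B}(f)-I_d(f)\big|^2\Big)^{1/2}\le c\,n^{-r-1/2}\,\|f\|_{H^{r,\mathrm{mix}}([0,1]^d)} .$$ -/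

import Mathlib

open MeasureTheory ProbabilityTheory
open scoped Matrix

namespace FrolovMix

noncomputable section

open scoped ContDiff

/-! ### Sobolev spaces of dominating mixed smoothness

Points of `ℝ^d` are functions `Fin d → ℝ`, with Lebesgue measure `volume`. -/

/-- The classical partial derivative of `φ` in the `i`-th coordinate direction. -/
def partialDeriv {d : ℕ} (i : Fin d) (φ : (Fin d → ℝ) → ℝ) : (Fin d → ℝ) → ℝ :=
  fun x => fderiv ℝ φ x (Pi.single i 1)

/-- The classical derivative `D^α φ` for a multi-index `α`: the partial derivative in direction `i`
is applied `α i` times, for every `i`. -/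
def multiDeriv {d : ℕ} (α : Fin d → ℕ) (φ : (Fin d → ℝ) → ℝ) : (Fin d → ℝ) → ℝ :=
  (List.finRange d).foldr (fun i ψ => (partialDeriv i)^[α i] ψ) φ

/-- `g` is a weak derivative `D^α f` on the open set `O`. -/
def IsWeakDeriv {d : ℕ} (O : Set (Fin d → ℝ)) (α : Fin d → ℕ) (f g : (Fin d → ℝ) → ℝ) : Prop :=
  LocallyIntegrableOn f O ∧ LocallyIntegrableOn g O ∧
    ∀ φ : (Fin d → ℝ) → ℝ, ContDiff ℝ ∞ φ → HasCompactSupport φ → tsupport φ ⊆ O →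
      ∫ x in O, f x * multiDeriv α φ x = (-1) ^ (∑ i, α i) * ∫ x in O, g x * φ x

open Classical in
/-- The weak derivative `D^α f` on `O` (unique up to a null set), and `0` if there is none. -/
def weakDeriv {d : ℕ} (O : Set (Fin d → ℝ)) (α : Fin d → ℕ) (f : (Fin d → ℝ) → ℝ) :
    (Fin d → ℝ) → ℝ :=
  if h : ∃ g, IsWeakDeriv O α f g then h.choose else 0

/-- Membership in `H^{r,mix}(O)`: `f ∈ L²(O)`, and for every `α ∈ {0,…,r}^d` the weak derivative
`D^α f` exists and lies in `L²(O)`. -/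
def MemHMix {d : ℕ} (O : Set (Fin d → ℝ)) (r : ℕ) (f : (Fin d → ℝ) → ℝ) : Prop :=
  MemLp f 2 (volume.restrict O) ∧
    ∀ α : Fin d → ℕ, (∀ i, α i ≤ r) → ∃ g, IsWeakDeriv O α f g ∧ MemLp g 2 (volume.restrict O)

/-- The norm of `H^{r,mix}(O)`: the square root of `∑_{α ∈ {0,…,r}^d} ‖D^α f‖²_{L²(O)}`. -/
def hMixNorm {d : ℕ} (O : Set (Fin d → ℝ)) (r : ℕ) (f : (Fin d → ℝ) → ℝ) : ℝ :=
  Real.sqrt (∑ α ∈ Finset.Iic (fun _ : Fin d => r), ∫ x in O, (weakDeriv O α f x) ^ 2)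

/-- The open unit cube `(0,1)^d`. -/
def openCube (d : ℕ) : Set (Fin d → ℝ) := Set.univ.pi fun _ => Set.Ioo 0 1

/-- The norm of `H^{r,mix}([0,1]^d)`. The boundary of the cube is a null set, so that `L²([0,1]^d)`
is `L²((0,1)^d)`; weak derivatives are those on the interior. -/
def cubeNorm {d : ℕ} (r : ℕ) (f : (Fin d → ℝ) → ℝ) : ℝ := hMixNorm (openCube d) r f

/-- Membership in the space of functions in `H^{r,mix}(ℝ^d)` with support in the unit cube
`[0,1]^d`. Elements are identified with their continuous representatives. -/
def MemHMixCube {d : ℕ} (r : ℕ) (f : (Fin d → ℝ) → ℝ) : Prop :=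
  Continuous f ∧ tsupport f ⊆ Set.Icc 0 1 ∧ MemHMix Set.univ r f

/-! ### Frolov matrices and the quadrature rule -/

/-- The image `B m` of an integer vector `m`. -/
def latticePoint {d : ℕ} (B : Matrix (Fin d) (Fin d) ℝ) (m : Fin d → ℤ) : Fin d → ℝ :=
  B *ᵥ (fun i => (m i : ℝ))

/-- Frolov matrices. In `card_le`, `Set.uIcc x y` is the box of all `z` such that every `z j` lies
between `x j` and `y j`. -/
structure IsFrolovMatrix {d : ℕ} (B : Matrix (Fin d) (Fin d) ℝ) : Prop where
  isUnit : IsUnit B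
  one_le_prod : ∀ m : Fin d → ℤ, m ≠ 0 → 1 ≤ |∏ j, latticePoint B m j|
  card_le : ∀ x y : Fin d → ℝ,
    {m : Fin d → ℤ | latticePoint B m ∈ Set.uIcc x y}.Finite ∧
    ({m : Fin d → ℤ | latticePoint B m ∈ Set.uIcc x y}.ncard : ℝ) ≤ ∏ j, |x j - y j| + 1

/-- The rule `Q_S^v(f) = |det S|⁻¹ ∑_{m ∈ ℤ^d} f(S^{-⊤}(m + v))`. -/
def quadRule {d : ℕ} (S : Matrix (Fin d) (Fin d) ℝ) (v : Fin d → ℝ) (f : (Fin d → ℝ) → ℝ) : ℝ :=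
  |S.det|⁻¹ * ∑' m : Fin d → ℤ, f ((S⁻¹)ᵀ *ᵥ (fun i => (m i : ℝ) + v i))

/-- The matrix `n^{1/d} û B`, with `û = diag(u_1,…,u_d)`. -/
def dilated {d : ℕ} (n : ℕ) (u : Fin d → ℝ) (B : Matrix (Fin d) (Fin d) ℝ) :
    Matrix (Fin d) (Fin d) ℝ :=
  ((n : ℝ) ^ (1 / (d : ℝ))) • (Matrix.diagonal u * B)

end

end FrolovMix

namespace FrolovMix

noncomputable section

open scoped ENNReal NNReal Topology

/-! ### Parseval on the unit cube -/

section Parseval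

-- The random shift and the random dilation play separate roles. For a fixed invertible S the error,
-- as a function of the shift v in the unit cube, has Fourier coefficients f̂(Sk) for k ≠ 0 and 0
-- for k = 0 (`integral_character_mul_quadRule`): folding the integer translates of the cube turns
-- the sum over nodes into one integral over ℝ^d. Parseval then bounds the mean square over the
-- shift by ∑_{k≠0} |f̂(Sk)|² (`lintegral_quadRule_sub_sq_le`). Working in L² of the shift avoids
-- any pointwise Poisson summation.
--
-- For S = n^{1/d} û B, averaging over u replaces this lattice sum by an integral of |f̂|² against a
-- weight (`lintegral_tsum_dilated_le`). At x the weight adds 1/∏|n^{1/d}(Bk)_i| over those k ≠ 0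
-- that some admissible dilation moves to x. Write p = ∏|x_i|. Condition (b) makes the weight vanish
-- when p < n. Otherwise each summand is at most 2/p, since the dilation changes the product by a
-- factor of at most 2, and condition (c) allows at most p/n + 1 ≤ 2p/n summands. So the weight is
-- at most 4/n.
--
-- On the region p ≥ n the transform of g = D^{(r,…,r)} f satisfies |ĝ| ≥ n^r |f̂|, and Plancherel
-- gives the factor n^{-2r} (`lintegral_fourierInt_hyperbolic_le`). The square root of n^{-1}
-- n^{-2r} is the rate; the extra 1/2 in the exponent comes from the dilations.

local instance : MeasureSpace UnitAddCircle := ⟨AddCircle.haarAddCircle⟩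

local instance : Measure.IsAddHaarMeasure (volume : Measure UnitAddCircle) :=
  inferInstanceAs (Measure.IsAddHaarMeasure AddCircle.haarAddCircle)

local instance : IsProbabilityMeasure (volume : Measure UnitAddCircle) :=
  inferInstanceAs (IsProbabilityMeasure AddCircle.haarAddCircle)

/-- The character `x ↦ exp (-2πi ξ·x)`. -/
def character {d : ℕ} (ξ x : Fin d → ℝ) : ℂ :=
  Complex.exp (-(2 * Real.pi * Complex.I) * ((ξ ⬝ᵥ x : ℝ) : ℂ))

/-- The integer vector `k`, as a real vector. -/
def intVec {d : ℕ} (k : Fin d → ℤ) : Fin d → ℝ := fun i => (k i : ℝ)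

/-- The k-th coefficient on the torus pairs with the monomial of index -k, which is why `character`
carries the minus sign. -/
lemma mFourier_neg_coe {d : ℕ} (k : Fin d → ℤ) (x : Fin d → ℝ) :
    UnitAddTorus.mFourier (-k) (fun i => (x i : UnitAddCircle)) = character (intVec k) x := by
  simp only [UnitAddTorus.mFourier, ContinuousMap.coe_mk, fourier_coe_apply, character,
    ← Complex.exp_sum, dotProduct, intVec]
  congr 1
  push_cast
  rw [Finset.mul_sum]
  refine Finset.sum_congr rfl fun i _ => ?_
  simp
  ring

lemma restrict_pi_Ioc_eq {d : ℕ} :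
    (volume : Measure (Fin d → ℝ)).restrict {x | ∀ i, x i ∈ Set.Ioc ((0 : Fin d → ℝ) i)
      ((0 : Fin d → ℝ) i + 1)} = volume.restrict (Set.Icc 0 1) := by
  have : {x : Fin d → ℝ | ∀ i, x i ∈ Set.Ioc ((0 : Fin d → ℝ) i) ((0 : Fin d → ℝ) i + 1)}
      = Set.univ.pi fun i => Set.Ioc ((0 : Fin d → ℝ) i) ((1 : Fin d → ℝ) i) := by
    ext x; simp
  rw [this]
  exact Measure.restrict_congr_set Measure.univ_pi_Ioc_ae_eq_Icc

/-- Parseval's identity on the unit cube. -/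
theorem parseval_cube {d : ℕ} (h : (Fin d → ℝ) → ℂ)
    (hh : MemLp h 2 (volume.restrict (Set.Icc 0 1))) :
    ∑' k : Fin d → ℤ, ‖∫ x in Set.Icc 0 1, character (intVec k) x * h x‖ₑ ^ 2
      = ∫⁻ x in Set.Icc 0 1, ‖h x‖ₑ ^ 2 := by
  set A : Set (Fin d → ℝ) := {x | ∀ i, x i ∈ Set.Ioc ((0 : Fin d → ℝ) i) ((0 : Fin d → ℝ) i + 1)}
    with hA
  have hAm : MeasurableSet A := by
    have : A = Set.univ.pi fun i => Set.Ioc ((0 : Fin d → ℝ) i) ((0 : Fin d → ℝ) i + 1) := by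
      ext x; simp [A]
    rw [this]
    exact MeasurableSet.univ_pi fun i => measurableSet_Ioc
  -- The half-open cube is a fundamental domain of the torus, so h transfers to it without change of
  -- norm.
  have hmp : MeasurePreserving
      (fun t : UnitAddTorus (Fin d) =>
        ((UnitAddTorus.measurableEquivPiIoc (0 : Fin d → ℝ) t : {x : Fin d → ℝ // _}) : Fin d → ℝ))
      volume (volume.restrict A) := by
    have h1 := UnitAddTorus.measurePreserving_equivPiIoc (d := Fin d) (a := 0)
    have h2 : MeasurePreserving (Subtype.val : A → (Fin d → ℝ))
        (Measure.comap Subtype.val volume) (volume.restrict A) :=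
      ⟨measurable_subtype_coe, map_comap_subtype_coe hAm _⟩
    exact h2.comp h1
  rw [← restrict_pi_Ioc_eq] at hh ⊢
  set H : UnitAddTorus (Fin d) → ℂ := fun t =>
    h ((UnitAddTorus.measurableEquivPiIoc (0 : Fin d → ℝ) t : {x : Fin d → ℝ // _}) : Fin d → ℝ)
    with hH
  have hHL : MemLp H 2 volume := hh.comp_measurePreserving hmp
  have hHA : ∀ x ∈ A, H (fun i => (x i : UnitAddCircle)) = h x := by
    intro x hx
    have := (UnitAddTorus.measurableEquivPiIoc (0 : Fin d → ℝ)).apply_symm_apply ⟨x, hx⟩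
    rw [UnitAddTorus.coe_symm_measurableEquivPiIoc_apply] at this
    simp only [hH, this]
  have hcoef : ∀ k, UnitAddTorus.mFourierCoeff (hHL.toLp H) k
      = ∫ x in A, character (intVec k) x * h x := by
    intro k
    have : UnitAddTorus.mFourierCoeff (hHL.toLp H) k = UnitAddTorus.mFourierCoeff H k := by
      refine integral_congr_ae ?_
      filter_upwards [hHL.coeFn_toLp] with t ht
      rw [ht]
    rw [this, UnitAddTorus.mFourierCoeff_eq_integral _ _ 0]
    refine setIntegral_congr_fun hAm fun x hx => ?_
    simp only [smul_eq_mul]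
    rw [hHA x hx, mFourier_neg_coe]
  have hs := UnitAddTorus.hasSum_sq_mFourierCoeff (hHL.toLp H)
  simp only [hcoef] at hs
  have hint : ∫ t, ‖(hHL.toLp H : UnitAddTorus (Fin d) → ℂ) t‖ ^ 2 = ∫ t, ‖H t‖ ^ 2 := by
    refine integral_congr_ae ?_
    filter_upwards [hHL.coeFn_toLp] with t ht
    rw [ht]
  rw [hint] at hs
  have hlin : ∫⁻ x in A, ‖h x‖ₑ ^ 2 = ∫⁻ t, ‖H t‖ₑ ^ 2 := by
    rw [UnitAddTorus.lintegral_preimage _ 0]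
    refine setLIntegral_congr_fun hAm fun x hx => ?_
    rw [hHA x hx]
  rw [hlin]
  have hsq : ∀ z : ℂ, ‖z‖ₑ ^ 2 = ENNReal.ofReal (‖z‖ ^ 2) := fun z => by
    rw [ENNReal.ofReal_pow (norm_nonneg _), ofReal_norm]
  simp only [hsq]
  rw [← ENNReal.ofReal_tsum_of_nonneg (fun _ => by positivity) hs.summable, hs.tsum_eq,
    ofReal_integral_eq_lintegral_ofReal]
  · exact hHL.integrable_norm_pow (by norm_num)
  · exact Filter.Eventually.of_forall fun _ => by positivity

end Parseval

/-! ### Unfolding over integer translates, and Plancherel -/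

/-- Lebesgue measure on `ℝ^d` is the sum of the integer translates of its restriction to the
unit cube. -/
theorem volume_eq_sum_translates (d : ℕ) :
    (volume : Measure (Fin d → ℝ)) = Measure.sum fun m : Fin d → ℤ =>
      (volume.restrict (Set.Icc (0 : Fin d → ℝ) 1)).map (fun x => intVec m + x) := by
  set T : (Fin d → ℤ) → Set (Fin d → ℝ) := fun m => {x | ∀ i, ⌊x i⌋ = m i} with hT
  have hTm : ∀ m, MeasurableSet (T m) := by
    intro m
    have : T m = ⋂ i, (fun x : Fin d → ℝ => ⌊x i⌋) ⁻¹' {m i} := by ext x; simp [T]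
    rw [this]
    exact MeasurableSet.iInter fun i =>
      (Int.measurable_floor.comp (measurable_pi_apply i)) (measurableSet_singleton _)
  have hTd : Pairwise (Function.onFun Disjoint T) := by
    intro m m' hmm
    refine Set.disjoint_left.mpr fun x hx hx' => hmm ?_
    ext i
    rw [← hx i, ← hx' i]
  have hTu : ⋃ m, T m = Set.univ :=
    Set.eq_univ_of_forall fun x => Set.mem_iUnion.mpr ⟨fun i => ⌊x i⌋, fun _ => rfl⟩
  conv_lhs => rw [← Measure.restrict_univ (μ := (volume : Measure (Fin d → ℝ))), ← hTu,
    Measure.restrict_iUnion hTd hTm]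
  congr 1
  ext1 m
  have hpre : (fun x : Fin d → ℝ => intVec m + x) ⁻¹' T m
      = Set.univ.pi fun i => Set.Ico ((0 : Fin d → ℝ) i) ((1 : Fin d → ℝ) i) := by
    ext x
    simp only [T, intVec, Set.mem_preimage, Set.mem_ofPred_eq, Pi.add_apply, Int.floor_intCast_add,
      Set.mem_pi, Set.mem_univ, true_implies, Set.mem_Ico, Pi.zero_apply, Pi.one_apply]
    refine forall_congr' fun i => ?_
    rw [add_eq_left, Int.floor_eq_zero_iff, Set.mem_Ico]
  have hae : (volume : Measure (Fin d → ℝ)).restrict (Set.Icc 0 1)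
      = volume.restrict ((fun x : Fin d → ℝ => intVec m + x) ⁻¹' T m) := by
    rw [hpre]
    exact (Measure.restrict_congr_set Measure.univ_pi_Ico_ae_eq_Icc).symm
  rw [hae, ← Measure.restrict_map (measurable_const_add _) (hTm m), map_add_left_eq_self]

instance isProbabilityMeasure_restrict_cube (d : ℕ) :
    IsProbabilityMeasure (volume.restrict (Set.Icc (0 : Fin d → ℝ) 1)) :=
  ⟨by simp [Real.volume_Icc_pi]⟩

lemma norm_character {d : ℕ} (ξ x : Fin d → ℝ) : ‖character ξ x‖ = 1 := by
  have : -(2 * Real.pi * Complex.I) * ((ξ ⬝ᵥ x : ℝ) : ℂ)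
      = ((-(2 * Real.pi) * (ξ ⬝ᵥ x) : ℝ) : ℂ) * Complex.I := by push_cast; ring
  rw [character, this, Complex.norm_exp_ofReal_mul_I]

lemma enorm_character_mul {d : ℕ} (ξ x : Fin d → ℝ) (z : ℂ) : ‖character ξ x * z‖ₑ = ‖z‖ₑ := by
  rw [enorm_mul, ← ofReal_norm (character ξ x), norm_character]; simp

lemma character_add_left {d : ℕ} (ξ η x : Fin d → ℝ) :
    character (ξ + η) x = character ξ x * character η x := by
  simp only [character, add_dotProduct, ← Complex.exp_add]
  congr 1; push_cast; ring

lemma character_add_right {d : ℕ} (ξ x y : Fin d → ℝ) :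
    character ξ (x + y) = character ξ x * character ξ y := by
  simp only [character, dotProduct_add, ← Complex.exp_add]
  congr 1; push_cast; ring

lemma continuous_character {d : ℕ} :
    Continuous fun p : (Fin d → ℝ) × (Fin d → ℝ) => character p.1 p.2 := by
  unfold character dotProduct
  fun_prop

lemma continuous_character_left {d : ℕ} (x : Fin d → ℝ) : Continuous fun ξ => character ξ x :=
  continuous_character.comp (by fun_prop : Continuous fun ξ : Fin d → ℝ => (ξ, x))

lemma continuous_character_right {d : ℕ} (ξ : Fin d → ℝ) : Continuous fun x => character ξ x :=
  continuous_character.comp (by fun_prop : Continuous fun x : Fin d → ℝ => (ξ, x))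

lemma character_intVec_intVec {d : ℕ} (k m : Fin d → ℤ) :
    character (intVec k) (intVec m) = 1 := by
  rw [character, Complex.exp_eq_one_iff]
  refine ⟨-∑ i, k i * m i, ?_⟩
  simp only [dotProduct, intVec]
  push_cast
  ring

/-- The Fourier integral `f̂(ξ) = ∫ f(x) exp (-2πi ξ·x) dx`. -/
def fourierInt {d : ℕ} (f : (Fin d → ℝ) → ℝ) (ξ : Fin d → ℝ) : ℂ :=
  ∫ x, character ξ x * (f x : ℂ)

lemma integrable_character_mul {d : ℕ} {f : (Fin d → ℝ) → ℝ} {μ : Measure (Fin d → ℝ)}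
    (hf : Integrable f μ) (ξ : Fin d → ℝ) : Integrable (fun x => character ξ x * (f x : ℂ)) μ :=
  hf.ofReal.bdd_mul (continuous_character_right ξ).aestronglyMeasurable
    (Filter.Eventually.of_forall fun x => (norm_character ξ x).le)

lemma continuous_fourierInt {d : ℕ} {f : (Fin d → ℝ) → ℝ} (hf : Integrable f) :
    Continuous (fourierInt f) := by
  refine continuous_of_dominated (bound := fun x => ‖f x‖)
    (fun ξ => (integrable_character_mul hf ξ).aestronglyMeasurable) (fun ξ => ?_) hf.norm ?_
  · exact Filter.Eventually.of_forall fun x => by simp [norm_character]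
  · exact Filter.Eventually.of_forall fun x =>
      (continuous_character_left x).mul continuous_const

/-- Plancherel's identity for square-integrable functions that vanish outside the unit cube. -/
theorem plancherel_cube {d : ℕ} {g : (Fin d → ℝ) → ℝ} (hg : MemLp g 2 volume)
    (h0 : ∀ᵐ x, x ∉ Set.Icc (0 : Fin d → ℝ) 1 → g x = 0) :
    ∫⁻ ξ, ‖fourierInt g ξ‖ₑ ^ 2 = ∫⁻ x in Set.Icc 0 1, ‖g x‖ₑ ^ 2 := by
  have hgI : IntegrableOn g (Set.Icc 0 1) := (hg.restrict _).integrable (by norm_num)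
  have hint : Integrable g := hgI.integrable_of_ae_notMem_eq_zero h0
  have hcube : ∀ ξ, fourierInt g ξ = ∫ x in Set.Icc 0 1, character ξ x * (g x : ℂ) := by
    intro ξ
    refine (setIntegral_eq_integral_of_ae_compl_eq_zero ?_).symm
    filter_upwards [h0] with x hx hxc
    simp [hx hxc]
  have hmeas := (continuous_fourierInt hint).measurable
  conv_lhs => rw [volume_eq_sum_translates d, lintegral_sum_measure]
  -- The value of the transform at m + t is the m-th Fourier coefficient of `character t` times g.
  -- Parseval applies for each t, and the modulus-one twist leaves the norm independent of t.
  have h1 : ∀ m : Fin d → ℤ, ∫⁻ ξ, ‖fourierInt g ξ‖ₑ ^ 2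
      ∂((volume.restrict (Set.Icc (0 : Fin d → ℝ) 1)).map (fun x => intVec m + x))
      = ∫⁻ t in Set.Icc 0 1, ‖∫ x in Set.Icc 0 1,
          character (intVec m) x * (character t x * (g x : ℂ))‖ₑ ^ 2 := by
    intro m
    rw [lintegral_map (hmeas.enorm.pow_const 2) (measurable_const_add _)]
    simp only [hcube, character_add_left, mul_assoc]
  simp only [h1]
  rw [← lintegral_tsum]
  · have h2 : ∀ t, ∑' m : Fin d → ℤ, ‖∫ x in Set.Icc 0 1,
          character (intVec m) x * (character t x * (g x : ℂ))‖ₑ ^ 2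
        = ∫⁻ x in Set.Icc 0 1, ‖g x‖ₑ ^ 2 := by
      intro t
      rw [parseval_cube]
      · simp only [enorm_character_mul]
        refine lintegral_congr fun x => ?_
        simp [← ofReal_norm]
      · refine (hg.restrict _).of_le ?_ ?_
        · exact (continuous_character_right t).aestronglyMeasurable.mul
            (hg.restrict _).ofReal.aestronglyMeasurable
        · exact Filter.Eventually.of_forall fun x => by simp [norm_character]
    simp only [h2]
    simp
  · intro m
    have : Measurable fun t => ‖fourierInt g (intVec m + t)‖ₑ ^ 2 :=
      (hmeas.comp (measurable_const_add _)).enorm.pow_const 2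
    simp only [hcube, character_add_left, mul_assoc] at this
    exact this.aemeasurable

/-! ### Fourier analysis of the shifted lattice rule -/

/-- Substitution of an invertible matrix in an integral. -/
lemma integral_comp_mulVec {d : ℕ} {M : Matrix (Fin d) (Fin d) ℝ} (hM : M.det ≠ 0)
    {F : (Fin d → ℝ) → ℂ} (hF : Continuous F) :
    ∫ y, F (M *ᵥ y) = (|M.det⁻¹| : ℝ) * ∫ x, F x := by
  have h := Real.map_matrix_volume_pi_eq_smul_volume_pi hM
  have h2 : ∫ x, F x ∂(Measure.map (Matrix.toLin' M) volume) = ∫ y, F (M *ᵥ y) := by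
    rw [integral_map (LinearMap.continuous_of_finiteDimensional _).measurable.aemeasurable
      hF.aestronglyMeasurable]
    rfl
  rw [← h2, h, integral_smul_measure, ENNReal.toReal_ofReal (abs_nonneg _)]
  simp

lemma hasCompactSupport_comp_mulVec {d : ℕ} {M : Matrix (Fin d) (Fin d) ℝ} (hM : M.det ≠ 0)
    {f : (Fin d → ℝ) → ℝ} (hf : HasCompactSupport f) :
    HasCompactSupport fun y => f (M *ᵥ y) := by
  have hker : LinearMap.ker (Matrix.toLin' M) = ⊥ := LinearMap.ker_eq_bot.mpr
    (Matrix.mulVec_injective_of_isUnit ((Matrix.isUnit_iff_isUnit_det _).mpr hM.isUnit))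
  exact hf.comp_isClosedEmbedding (LinearMap.isClosedEmbedding_of_injective hker)

lemma det_inv_transpose {d : ℕ} (S : Matrix (Fin d) (Fin d) ℝ) :
    ((S⁻¹)ᵀ).det = S.det⁻¹ := by
  rw [Matrix.det_transpose, Matrix.det_nonsing_inv, Ring.inverse_eq_inv']

/-- The Fourier coefficients in the shift of the shifted lattice rule. -/
theorem integral_character_mul_quadRule {d : ℕ} {S : Matrix (Fin d) (Fin d) ℝ} (hS : IsUnit S)
    {f : (Fin d → ℝ) → ℝ} (hf : Continuous f) (hfc : HasCompactSupport f) (k : Fin d → ℤ) :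
    ∫ v in Set.Icc 0 1, character (intVec k) v * (quadRule S v f : ℂ)
      = fourierInt f (S *ᵥ intVec k) := by
  have hdet : S.det ≠ 0 := ((Matrix.isUnit_iff_isUnit_det _).mp hS).ne_zero
  have hMdet : ((S⁻¹)ᵀ).det = S.det⁻¹ := det_inv_transpose S
  set M := (S⁻¹)ᵀ with hM
  -- The inverse transpose in the rule is what turns the frequency k of the shift into the frequency
  -- Sk of f.
  have hSM : ∀ y, (S *ᵥ intVec k) ⬝ᵥ (M *ᵥ y) = intVec k ⬝ᵥ y := by
    intro y
    rw [Matrix.dotProduct_mulVec, hM, Matrix.vecMul_transpose, Matrix.mulVec_mulVec,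
      Matrix.nonsing_inv_mul _ (Ne.isUnit hdet), Matrix.one_mulVec]
  set G : (Fin d → ℝ) → ℂ := fun y => character (intVec k) y * (f (M *ᵥ y) : ℂ) with hG
  have hGF : ∀ y, G y = character (S *ᵥ intVec k) (M *ᵥ y) * (f (M *ᵥ y) : ℂ) := by
    intro y; simp only [hG, character, hSM]
  have hGc : Continuous G :=
    (continuous_character_right _).mul (Complex.continuous_ofReal.comp
      (hf.comp (Continuous.matrix_mulVec continuous_const continuous_id)))
  have hMc : HasCompactSupport fun y => f (M *ᵥ y) := hasCompactSupport_comp_mulVec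
    (by rw [hMdet]; exact inv_ne_zero hdet) hfc
  have hGs : HasCompactSupport G := by
    refine hMc.mono' ?_
    refine subset_trans ?_ subset_closure
    intro y hy hy0
    exact hy (by simp [hG, hy0])
  have hGi : Integrable G := hGc.integrable_of_hasCompactSupport hGs
  have h1 : fourierInt f (S *ᵥ intVec k) = (|S.det|⁻¹ : ℝ) * ∫ y, G y := by
    simp only [hGF]
    rw [integral_comp_mulVec (M := M) (F := fun x => character (S *ᵥ intVec k) x * (f x : ℂ))
      (by rw [hMdet]; exact inv_ne_zero hdet)
      ((continuous_character_right _).mul (Complex.continuous_ofReal.comp hf)), hMdet, inv_inv,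
      ← mul_assoc, ← Complex.ofReal_mul, inv_mul_cancel₀ (abs_ne_zero.mpr hdet)]
    simp [fourierInt]
  have hGi' := hGi
  rw [volume_eq_sum_translates d] at hGi'
  have hmap : ∀ {E : Type} [NormedAddCommGroup E] [NormedSpace ℝ E] (H : (Fin d → ℝ) → E)
      (_ : Continuous H) (m : Fin d → ℤ), ∫ y, H y
        ∂((volume.restrict (Set.Icc (0 : Fin d → ℝ) 1)).map (fun x => intVec m + x))
        = ∫ v in Set.Icc 0 1, H (intVec m + v) := fun H hH m =>
    integral_map_of_stronglyMeasurable (measurable_const_add _) hH.stronglyMeasurable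
  have h2 : ∫ y, G y = ∑' m : Fin d → ℤ, ∫ v in Set.Icc 0 1, G (intVec m + v) := by
    conv_lhs => rw [volume_eq_sum_translates d, integral_sum_measure hGi']
    exact tsum_congr fun m => hmap G hGc m
  have h3 : Summable fun m : Fin d → ℤ => ∫ v in Set.Icc 0 1, ‖G (intVec m + v)‖ := by
    have := (hasSum_integral_measure hGi'.norm).summable
    simpa only [hmap _ hGc.norm] using this
  -- Integer translations do not change the character, so the sum over m acts on f alone and
  -- rebuilds the rule.
  have h4 : ∀ (m : Fin d → ℤ) v, G (intVec m + v)
      = character (intVec k) v * (f (M *ᵥ (intVec m + v)) : ℂ) := by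
    intro m v
    simp only [hG, character_add_right, character_intVec_intVec, one_mul]
  rw [h1, h2, integral_tsum_of_summable_integral_norm _ h3, ← integral_const_mul]
  · refine integral_congr_ae (Filter.Eventually.of_forall fun v => ?_)
    simp only [h4, quadRule]
    rw [tsum_mul_left]
    push_cast
    rw [mul_left_comm]
    rfl
  · intro m
    exact ((hGc.comp (continuous_const_add _)).continuousOn).integrableOn_compact isCompact_Icc

open scoped Pointwise in
/-- Only finitely many nodes of a lattice rule, shifted by vectors of the unit cube, lie in the
support of a compactly supported function. -/
lemma exists_finset_node_eq_zero {d : ℕ} {M : Matrix (Fin d) (Fin d) ℝ} (hM : M.det ≠ 0)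
    {f : (Fin d → ℝ) → ℝ} (hf : HasCompactSupport f) :
    ∃ s : Finset (Fin d → ℤ), ∀ v ∈ Set.Icc (0 : Fin d → ℝ) 1, ∀ m ∉ s,
      f (M *ᵥ (intVec m + v)) = 0 := by
  have hK : Bornology.IsBounded (tsupport (fun y => f (M *ᵥ y)) - Set.Icc (0 : Fin d → ℝ) 1) :=
    (hasCompactSupport_comp_mulVec hM hf).isCompact.isBounded.sub isCompact_Icc.isBounded
  obtain ⟨R, hR⟩ := hK.exists_norm_le
  refine ⟨Finset.Icc (fun _ => -⌈R⌉) (fun _ => ⌈R⌉), fun v hv m hm => ?_⟩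
  by_contra hne
  refine hm (Finset.mem_Icc.mpr ?_)
  have hmem : intVec m ∈ tsupport (fun y => f (M *ᵥ y)) - Set.Icc (0 : Fin d → ℝ) 1 :=
    ⟨intVec m + v, subset_closure hne, v, hv, by simp⟩
  have hi : ∀ i, |(m i : ℝ)| ≤ ⌈R⌉ := fun i =>
    ((norm_le_pi_norm (intVec m) i).trans (hR _ hmem)).trans (Int.le_ceil R)
  have hi' : ∀ i, |m i| ≤ ⌈R⌉ := fun i => by exact_mod_cast hi i
  exact ⟨fun i => (abs_le.mp (hi' i)).1, fun i => (abs_le.mp (hi' i)).2⟩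

/-- For shifts in the cube the series is one fixed finite sum, hence continuous and bounded there.
-/
lemma memLp_quadRule {d : ℕ} {S : Matrix (Fin d) (Fin d) ℝ} (hS : IsUnit S)
    {f : (Fin d → ℝ) → ℝ} (hf : Continuous f) (hfc : HasCompactSupport f) :
    MemLp (fun v => quadRule S v f) 2 (volume.restrict (Set.Icc 0 1)) := by
  have hdet : S.det ≠ 0 := ((Matrix.isUnit_iff_isUnit_det _).mp hS).ne_zero
  obtain ⟨s, hs⟩ := exists_finset_node_eq_zero (M := (S⁻¹)ᵀ)
    (by rw [det_inv_transpose]; exact inv_ne_zero hdet) hfc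
  set q : (Fin d → ℝ) → ℝ := fun v => |S.det|⁻¹ * ∑ m ∈ s, f ((S⁻¹)ᵀ *ᵥ (intVec m + v)) with hq
  have hqc : Continuous q := by
    refine continuous_const.mul (continuous_finsetSum _ fun m _ => hf.comp ?_)
    exact Continuous.matrix_mulVec continuous_const (by fun_prop)
  obtain ⟨C, hC⟩ := (isCompact_Icc (a := (0 : Fin d → ℝ)) (b := 1)).exists_bound_of_continuousOn
    hqc.continuousOn
  have hq2 : MemLp q 2 (volume.restrict (Set.Icc 0 1)) :=
    MemLp.of_bound hqc.aestronglyMeasurable C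
      ((ae_restrict_iff' measurableSet_Icc).mpr (Filter.Eventually.of_forall hC))
  refine hq2.ae_eq ((ae_restrict_iff' measurableSet_Icc).mpr
    (Filter.Eventually.of_forall fun v hv => ?_))
  simp only [hq, quadRule]
  congr 1
  exact (tsum_eq_sum fun m hm => hs v hv m hm).symm

/-- Parseval for the constant 1: the coefficient at 0 already exhausts the total mass 1. -/
lemma integral_cube_character {d : ℕ} {k : Fin d → ℤ} (hk : k ≠ 0) :
    ∫ x in Set.Icc (0 : Fin d → ℝ) 1, character (intVec k) x = 0 := by
  have h := parseval_cube (d := d) (fun _ => 1) (memLp_const 1)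
  simp only [mul_one, enorm_one, one_pow, lintegral_const, measure_univ] at h
  have h0 : ‖∫ x in Set.Icc (0 : Fin d → ℝ) 1, character (intVec 0) x‖ₑ ^ 2 = 1 := by
    simp [character, intVec, dotProduct]
  by_contra hne
  have hle := ENNReal.sum_le_tsum (f := fun k : Fin d → ℤ =>
    ‖∫ x in Set.Icc (0 : Fin d → ℝ) 1, character (intVec k) x‖ₑ ^ 2) {0, k}
  rw [Finset.sum_pair hk.symm, h0, h] at hle
  have hpos : 0 < ‖∫ x in Set.Icc (0 : Fin d → ℝ) 1, character (intVec k) x‖ₑ ^ 2 := by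
    exact pos_iff_ne_zero.mpr (pow_ne_zero 2 (by simpa using hne))
  exact absurd hle (not_le.mpr (ENNReal.lt_add_right ENNReal.one_ne_top hpos.ne'))

/-- The mean square error over the random shift, in terms of the Fourier transform on the dual
lattice. -/
theorem lintegral_quadRule_sub_sq_le {d : ℕ} {S : Matrix (Fin d) (Fin d) ℝ} (hS : IsUnit S)
    {f : (Fin d → ℝ) → ℝ} (hf : Continuous f) (hfc : HasCompactSupport f) :
    ∫⁻ v in Set.Icc 0 1, ‖quadRule S v f - ∫ x, f x‖ₑ ^ 2
      ≤ ∑' k : {k : Fin d → ℤ // k ≠ 0}, ‖fourierInt f (S *ᵥ intVec k.1)‖ₑ ^ 2 := by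
  have hQ := memLp_quadRule hS hf hfc
  have hmem : MemLp (fun v => ((quadRule S v f - ∫ x, f x : ℝ) : ℂ)) 2
      (volume.restrict (Set.Icc (0 : Fin d → ℝ) 1)) :=
    MemLp.ofReal (K := ℂ) (hQ.sub (memLp_const _))
  have hcoef : ∀ k : Fin d → ℤ, ∫ v in Set.Icc 0 1,
      character (intVec k) v * ((quadRule S v f - ∫ x, f x : ℝ) : ℂ)
      = fourierInt f (S *ᵥ intVec k)
        - (∫ v in Set.Icc (0 : Fin d → ℝ) 1, character (intVec k) v) * (∫ x, f x : ℝ) := by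
    intro k
    rw [← integral_character_mul_quadRule hS hf hfc, ← integral_mul_const, ← integral_sub]
    · simp only [Complex.ofReal_sub, mul_sub]
    · exact integrable_character_mul (hQ.integrable (by norm_num)) _
    · exact integrable_character_mul (integrable_const _) _
  have h := parseval_cube _ hmem
  simp only [hcoef] at h
  have henorm : ∀ a : ℝ, ‖(a : ℂ)‖ₑ = ‖a‖ₑ := fun a => by simp [← ofReal_norm]
  simp only [henorm] at h
  rw [← h]
  -- The subtracted integral cancels the coefficient at 0 and, by `integral_cube_character`, affects
  -- no other.
  have h0 : fourierInt f (S *ᵥ intVec 0)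
      - (∫ v in Set.Icc (0 : Fin d → ℝ) 1, character (intVec 0) v) * (∫ x, f x : ℝ) = 0 := by
    have hz : (intVec 0 : Fin d → ℝ) = 0 := by ext; simp [intVec]
    simp only [hz, Matrix.mulVec_zero, fourierInt, character, zero_dotProduct]
    simp [integral_complex_ofReal]
  rw [ENNReal.tsum_eq_add_tsum_ite 0, h0]
  simp only [enorm_zero, ne_eq, OfNat.ofNat_ne_zero, not_false_eq_true, zero_pow, zero_add]
  have hsub := tsum_subtype {k : Fin d → ℤ | k ≠ 0}
    fun k => ‖fourierInt f (S *ᵥ intVec k)‖ₑ ^ 2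
  refine le_of_le_of_eq ?_ hsub.symm
  refine ENNReal.tsum_le_tsum fun k => ?_
  by_cases hk : k = 0
  · simp [hk]
  · rw [if_neg hk, Set.indicator_of_mem (by exact hk), integral_cube_character hk]
    simp

open scoped ContDiff

/-! ### Weak derivatives and their Fourier transforms -/

section WeakDerivative

variable {d : ℕ}

lemma partialDeriv_congr {φ ψ : (Fin d → ℝ) → ℝ} {x : Fin d → ℝ} (h : φ =ᶠ[𝓝 x] ψ) (i : Fin d) :
    partialDeriv i φ =ᶠ[𝓝 x] partialDeriv i ψ := by
  filter_upwards [h.fderiv (𝕜 := ℝ)] with y hy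
  simp only [partialDeriv, hy]

/-- Classical derivatives depend only on germs; this removes the cut-off from a test function near
the support of f. -/
lemma multiDeriv_congr {φ ψ : (Fin d → ℝ) → ℝ} {x : Fin d → ℝ} (h : φ =ᶠ[𝓝 x] ψ)
    (α : Fin d → ℕ) : multiDeriv α φ =ᶠ[𝓝 x] multiDeriv α ψ := by
  unfold multiDeriv
  induction List.finRange d with
  | nil => exact h
  | cons i l ih =>
    simp only [List.foldr_cons]
    induction α i with
    | zero => exact ih
    | succ n ihn =>
      simp only [Function.iterate_succ_apply']
      exact partialDeriv_congr ihn i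

/-- Test functions are real. The free complex constant c absorbs the factor produced by
differentiation, so the family of real parts is closed under derivatives. -/
lemma partialDeriv_re_character (c : ℂ) (ξ : Fin d → ℝ) (i : Fin d) :
    partialDeriv i (fun x => (c * character ξ x).re)
      = fun x => (c * (-(2 * Real.pi * Complex.I * ξ i)) * character ξ x).re := by
  ext x
  set L : (Fin d → ℝ) →L[ℝ] ℝ := ∑ j, ξ j • ContinuousLinearMap.proj j with hL
  have hLx : ∀ y, ξ ⬝ᵥ y = L y := by
    intro y; simp [hL, dotProduct]
  have h1 : HasFDerivAt (fun y : Fin d → ℝ => ((ξ ⬝ᵥ y : ℝ) : ℂ)) (Complex.ofRealCLM.comp L) x := by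
    simp only [hLx]
    exact (Complex.ofRealCLM.comp L).hasFDerivAt
  have h2 := Complex.reCLM.hasFDerivAt.comp x
    (((h1.const_mul (-(2 * Real.pi * Complex.I))).cexp).const_mul c)
  have h3 : (fun y => (c * character ξ y).re) = Complex.reCLM ∘ fun y =>
      c * Complex.exp (-(2 * Real.pi * Complex.I) * ((ξ ⬝ᵥ y : ℝ) : ℂ)) := rfl
  have hLi : L (Pi.single i 1) = ξ i := by rw [← hLx, dotProduct_single_one]
  rw [partialDeriv, h3, h2.fderiv]
  simp only [ContinuousLinearMap.comp_apply, _root_.smul_apply, hLi,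
    Complex.ofRealCLM_apply, Complex.reCLM_apply, smul_eq_mul, character]
  congr 1
  ring

lemma multiDeriv_re_character (α : Fin d → ℕ) (c : ℂ) (ξ : Fin d → ℝ) :
    multiDeriv α (fun x => (c * character ξ x).re)
      = fun x => (c * (∏ i, (-(2 * Real.pi * Complex.I * ξ i)) ^ α i) * character ξ x).re := by
  have hiter : ∀ (i : Fin d) (n : ℕ) (c : ℂ),
      (partialDeriv i)^[n] (fun x => (c * character ξ x).re)
        = fun x => (c * (-(2 * Real.pi * Complex.I * ξ i)) ^ n * character ξ x).re := by
    intro i n c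
    induction n with
    | zero => simp
    | succ n ih => rw [Function.iterate_succ_apply', ih, partialDeriv_re_character, pow_succ,
        mul_assoc c]
  rw [multiDeriv, Fin.prod_univ_def]
  induction List.finRange d with
  | nil => simp
  | cons i l ih =>
    rw [List.foldr_cons, ih, hiter, List.map_cons, List.prod_cons]
    ext x
    congr 2
    ring

lemma multiDeriv_zero (α : Fin d → ℕ) : multiDeriv α (0 : (Fin d → ℝ) → ℝ) = 0 := by
  have h := multiDeriv_re_character (d := d) α 0 0
  simp only [zero_mul, Complex.zero_re] at h
  exact h

lemma multiDeriv_eq_zero_of_notMem_tsupport {φ : (Fin d → ℝ) → ℝ} {x : Fin d → ℝ}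
    (hx : x ∉ tsupport φ) (α : Fin d → ℕ) : multiDeriv α φ x = 0 := by
  have := (multiDeriv_congr (notMem_tsupport_iff_eventuallyEq.mp hx) α).self_of_nhds
  rw [this, multiDeriv_zero]
  rfl

/-- The Fourier transform of a weak derivative. -/
theorem norm_fourierInt_of_isWeakDeriv {α : Fin d → ℕ} {f g : (Fin d → ℝ) → ℝ}
    (hf : Integrable f) (hfs : tsupport f ⊆ Set.Icc 0 1) (hg : Integrable g)
    (hg0 : ∀ᵐ x, x ∉ Set.Icc (0 : Fin d → ℝ) 1 → g x = 0)
    (hfg : IsWeakDeriv Set.univ α f g) (ξ : Fin d → ℝ) :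
    ‖fourierInt g ξ‖ = (∏ i, (2 * Real.pi * |ξ i|) ^ α i) * ‖fourierInt f ξ‖ := by
  have hball : ∀ x ∈ Set.Icc (0 : Fin d → ℝ) 1, x ∈ Metric.ball (0 : Fin d → ℝ) 2 := by
    intro x hx
    rw [mem_ball_zero_iff]
    refine lt_of_le_of_lt ((pi_norm_le_iff_of_nonneg zero_le_one).mpr fun i => ?_) one_lt_two
    rw [Real.norm_eq_abs, abs_of_nonneg (hx.1 i)]
    exact hx.2 i
  -- The ball of radius 2 in the sup norm contains the cube, so χ is 1 near every point of it. The
  -- cut-off exponential is thus an admissible test function.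
  let χ : ContDiffBump (0 : Fin d → ℝ) := ⟨2, 3, by norm_num, by norm_num⟩
  have hχ : ∀ x ∈ Set.Icc (0 : Fin d → ℝ) 1, χ =ᶠ[𝓝 x] 1 := fun x hx =>
    χ.eventuallyEq_one_of_mem_ball (hball x hx)
  have hre : ∀ (h : (Fin d → ℝ) → ℝ) (_ : Integrable h) (c : ℂ),
      ∫ x, h x * (c * character ξ x).re = (c * fourierInt h ξ).re := by
    intro h hh c
    rw [fourierInt, ← integral_const_mul, ← RCLike.re_eq_complex_re,
      ← integral_re ((integrable_character_mul hh ξ).const_mul c)]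
    refine integral_congr_ae (Filter.Eventually.of_forall fun x => ?_)
    simp only [RCLike.re_eq_complex_re]
    rw [← mul_assoc, Complex.re_mul_ofReal, mul_comm]
  set Q : ℂ := ∏ i, (-(2 * Real.pi * Complex.I * ξ i)) ^ α i with hQ
  -- Taking c = 1 and c = i recovers the real and imaginary parts of the complex identity.
  have key : ∀ c : ℂ, (c * (Q * fourierInt f ξ)).re
      = (c * ((-1) ^ (∑ i, α i) * fourierInt g ξ)).re := by
    intro c
    set φ : (Fin d → ℝ) → ℝ := fun x => χ x * (c * character ξ x).re with hφ
    have hφs : ContDiff ℝ ∞ φ := by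
      refine χ.contDiff.mul ?_
      refine Complex.reCLM.contDiff.comp (contDiff_const.mul ?_)
      have hdot : ContDiff ℝ ∞ fun x : Fin d → ℝ => ξ ⬝ᵥ x := by
        unfold dotProduct
        fun_prop
      exact Complex.contDiff_exp.comp (contDiff_const.mul (Complex.ofRealCLM.contDiff.comp hdot))
    have hφc : HasCompactSupport φ := χ.hasCompactSupport.mul_right
    have h := hfg.2.2 φ hφs hφc (Set.subset_univ _)
    rw [setIntegral_univ, setIntegral_univ] at h
    have hl : ∫ x, f x * multiDeriv α φ x = (c * Q * fourierInt f ξ).re := by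
      rw [← hre f hf]
      refine integral_congr_ae (Filter.Eventually.of_forall fun x => ?_)
      by_cases hx : x ∈ tsupport f
      · have hev : φ =ᶠ[𝓝 x] fun y => (c * character ξ y).re := by
          filter_upwards [hχ x (hfs hx)] with y hy
          simp [hφ, hy]
        simp only []
        rw [(multiDeriv_congr hev α).self_of_nhds, multiDeriv_re_character]
      · simp [image_eq_zero_of_notMem_tsupport hx]
    have hr : ∫ x, g x * φ x = (c * fourierInt g ξ).re := by
      rw [← hre g hg]
      refine integral_congr_ae ?_
      filter_upwards [hg0] with x hx
      by_cases hxc : x ∈ Set.Icc (0 : Fin d → ℝ) 1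
      · simp [hφ, (hχ x hxc).self_of_nhds]
      · simp [hx hxc]
    rw [hl, hr] at h
    rw [← mul_assoc, h, mul_left_comm]
    have : ((-1 : ℂ) ^ (∑ i, α i)) = (((-1 : ℝ) ^ (∑ i, α i) : ℝ) : ℂ) := by push_cast; rfl
    rw [this, Complex.re_ofReal_mul]
  have heq : Q * fourierInt f ξ = (-1) ^ (∑ i, α i) * fourierInt g ξ := by
    refine Complex.ext ?_ ?_
    · simpa only [one_mul] using key 1
    · have := key Complex.I
      simp only [Complex.I_mul_re, neg_inj] at this
      exact this
  have hn := congrArg norm heq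
  rw [norm_mul, norm_mul, norm_pow, norm_neg, norm_one, one_pow, one_mul] at hn
  rw [← hn, hQ, norm_prod]
  congr 1
  refine Finset.prod_congr rfl fun i _ => ?_
  rw [norm_pow, norm_neg]
  simp [abs_of_pos Real.pi_pos]

lemma integrable_mul_of_tsupport_subset {O : Set (Fin d → ℝ)}
    {g φ : (Fin d → ℝ) → ℝ} (hg : LocallyIntegrableOn g O) (hφ : Continuous φ)
    (hc : HasCompactSupport φ) (hs : tsupport φ ⊆ O) : Integrable fun x => g x * φ x := by
  have h1 : IntegrableOn (fun x => g x * φ x) (tsupport φ) :=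
    (hg.integrableOn_compact_subset hs hc.isCompact).mul_continuousOn hφ.continuousOn hc.isCompact
  refine h1.integrable_of_forall_notMem_eq_zero fun x hx => ?_
  rw [image_eq_zero_of_notMem_tsupport hx, mul_zero]

/-- Weak derivatives are unique up to null sets. -/
theorem IsWeakDeriv.ae_eq {O : Set (Fin d → ℝ)} (hO : IsOpen O) {α : Fin d → ℕ}
    {f g h : (Fin d → ℝ) → ℝ} (hg : IsWeakDeriv O α f g) (hh : IsWeakDeriv O α f h) :
    g =ᵐ[volume.restrict O] h := by
  have key : ∀ᵐ x, x ∈ O → (g - h) x = 0 := by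
    refine hO.ae_eq_zero_of_integral_contDiff_smul_eq_zero (hg.2.1.sub hh.2.1) ?_
    intro φ hφ hφc hφs
    have h1 := hg.2.2 φ hφ hφc hφs
    rw [hh.2.2 φ hφ hφc hφs] at h1
    have h2 := mul_left_cancel₀ (pow_ne_zero _ (by norm_num)) h1
    have hz : ∀ u : (Fin d → ℝ) → ℝ, ∫ x in O, u x * φ x = ∫ x, u x * φ x := fun u =>
      setIntegral_eq_integral_of_forall_compl_eq_zero fun x hx => by
        rw [image_eq_zero_of_notMem_tsupport fun hx' => hx (hφs hx'), mul_zero]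
    rw [hz, hz] at h2
    simp only [smul_eq_mul, Pi.sub_apply, mul_comm (φ _), sub_mul]
    rw [integral_sub (integrable_mul_of_tsupport_subset hg.2.1 hφ.continuous hφc hφs)
      (integrable_mul_of_tsupport_subset hh.2.1 hφ.continuous hφc hφs), h2, sub_self]
  rw [Filter.EventuallyEq, ae_restrict_iff' hO.measurableSet]
  filter_upwards [key] with x hx hxO
  exact sub_eq_zero.mp (hx hxO)

/-- A weak derivative on an open set is one on every smaller set. -/
theorem IsWeakDeriv.mono {O O' : Set (Fin d → ℝ)} (hOO : O' ⊆ O) {α : Fin d → ℕ}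
    {f g : (Fin d → ℝ) → ℝ} (h : IsWeakDeriv O α f g) : IsWeakDeriv O' α f g := by
  refine ⟨h.1.mono_set hOO, h.2.1.mono_set hOO, fun φ hφ hφc hφs => ?_⟩
  have h1 := h.2.2 φ hφ hφc (hφs.trans hOO)
  have ha : ∀ A : Set (Fin d → ℝ), tsupport φ ⊆ A →
      ∫ x in A, f x * multiDeriv α φ x = ∫ x, f x * multiDeriv α φ x := fun A hA =>
    setIntegral_eq_integral_of_forall_compl_eq_zero fun x hx => by
      rw [multiDeriv_eq_zero_of_notMem_tsupport (fun hx' => hx (hA hx')), mul_zero]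
  have hb : ∀ A : Set (Fin d → ℝ), tsupport φ ⊆ A →
      ∫ x in A, g x * φ x = ∫ x, g x * φ x := fun A hA =>
    setIntegral_eq_integral_of_forall_compl_eq_zero fun x hx => by
      rw [image_eq_zero_of_notMem_tsupport (fun hx' => hx (hA hx')), mul_zero]
  rw [ha _ hφs, hb _ hφs, ← ha _ (hφs.trans hOO), ← hb _ (hφs.trans hOO), h1]

/-- The weak derivatives of a function vanish outside its support. -/
theorem IsWeakDeriv.ae_eq_zero_of_notMem {K : Set (Fin d → ℝ)} (hK : IsClosed K) {α : Fin d → ℕ}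
    {f g : (Fin d → ℝ) → ℝ} (h : IsWeakDeriv Set.univ α f g) (hf : tsupport f ⊆ K) :
    ∀ᵐ x, x ∉ K → g x = 0 := by
  refine hK.isOpen_compl.ae_eq_zero_of_integral_contDiff_smul_eq_zero
    (h.2.1.mono_set (Set.subset_univ _)) fun φ hφ hφc hφs => ?_
  have h1 := h.2.2 φ hφ hφc (Set.subset_univ _)
  rw [setIntegral_univ, setIntegral_univ] at h1
  have h0 : ∫ x, f x * multiDeriv α φ x = 0 := by
    refine integral_eq_zero_of_ae (Filter.Eventually.of_forall fun x => ?_)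
    by_cases hx : x ∈ K
    · simp only [Pi.zero_apply]
      rw [multiDeriv_eq_zero_of_notMem_tsupport (fun hx' => hφs hx' hx), mul_zero]
    · simp [image_eq_zero_of_notMem_tsupport fun hx' => hx (hf hx')]
  rw [h0] at h1
  simp only [smul_eq_mul, mul_comm (φ _)]
  exact (mul_eq_zero.mp h1.symm).resolve_left (pow_ne_zero _ (by norm_num))

lemma isOpen_openCube (d : ℕ) : IsOpen (openCube d) :=
  isOpen_set_pi Set.finite_univ fun _ _ => isOpen_Ioo

/-- The norm on the cube bounds the `L²` norm of the highest mixed derivative. -/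
theorem lintegral_sq_le_cubeNorm {r : ℕ} {f g : (Fin d → ℝ) → ℝ} (hg : MemLp g 2 volume)
    (hfg : IsWeakDeriv Set.univ (fun _ => r) f g) :
    ∫⁻ x in Set.Icc 0 1, ‖g x‖ₑ ^ 2 ≤ ENNReal.ofReal (cubeNorm r f ^ 2) := by
  -- The norm uses a chosen weak derivative on the open cube; uniqueness identifies it there with g.
  have hO := hfg.mono (Set.subset_univ (openCube d))
  have hex : ∃ g, IsWeakDeriv (openCube d) (fun _ => r) f g := ⟨g, hO⟩
  have hw : IsWeakDeriv (openCube d) (fun _ => r) f (weakDeriv (openCube d) (fun _ => r) f) := by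
    rw [weakDeriv, dif_pos hex]
    exact hex.choose_spec
  have hae := hw.ae_eq (isOpen_openCube d) hO
  have hres : (volume : Measure (Fin d → ℝ)).restrict (Set.Icc 0 1)
      = volume.restrict (openCube d) :=
    (Measure.restrict_congr_set Measure.univ_pi_Ioo_ae_eq_Icc).symm
  have hsq : ∀ x, ‖g x‖ₑ ^ 2 = ENNReal.ofReal (g x ^ 2) := fun x => by
    rw [← ofReal_norm, ← ENNReal.ofReal_pow (norm_nonneg _), Real.norm_eq_abs, sq_abs]
  simp only [hres, hsq]
  rw [← ofReal_integral_eq_lintegral_ofReal (hg.restrict _).integrable_sq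
    (Filter.Eventually.of_forall fun x => sq_nonneg _)]
  refine ENNReal.ofReal_le_ofReal ?_
  have hnn : ∀ α : Fin d → ℕ, 0 ≤ ∫ x in openCube d, (weakDeriv (openCube d) α f x) ^ 2 :=
    fun α => integral_nonneg fun x => sq_nonneg _
  rw [cubeNorm, hMixNorm, Real.sq_sqrt (Finset.sum_nonneg fun α _ => hnn α)]
  refine le_of_eq_of_le ?_ (Finset.single_le_sum (fun α _ => hnn α)
    (Finset.mem_Iic.mpr (le_refl (fun _ : Fin d => r))))
  refine integral_congr_ae ?_
  filter_upwards [hae] with x hx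
  rw [hx]

end WeakDerivative

/-! ### Averaging over random dilations -/

section Average

variable {d : ℕ}

lemma lintegral_diagonal_mulVec {w : Fin d → ℝ} (hw : ∀ i, w i ≠ 0) {H : (Fin d → ℝ) → ℝ≥0∞}
    (hH : Measurable H) :
    ∫⁻ u : Fin d → ℝ, H (fun i => w i * u i) = ENNReal.ofReal (∏ i, |w i|)⁻¹ * ∫⁻ x, H x := by
  have hdet : (Matrix.diagonal w).det ≠ 0 := by
    rw [Matrix.det_diagonal]
    exact Finset.prod_ne_zero_iff.mpr fun i _ => hw i
  have h := Real.map_matrix_volume_pi_eq_smul_volume_pi hdet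
  have h2 : ∫⁻ x, H x ∂(Measure.map (Matrix.toLin' (Matrix.diagonal w)) volume)
      = ∫⁻ u : Fin d → ℝ, H (fun i => w i * u i) := by
    rw [lintegral_map hH (LinearMap.continuous_of_finiteDimensional _).measurable]
    refine lintegral_congr fun u => ?_
    congr 1
    ext i
    simp [Matrix.mulVec_diagonal]
  rw [← h2, h, lintegral_smul_measure, Matrix.det_diagonal, abs_inv, Finset.abs_prod, smul_eq_mul]

lemma rpow_inv_pow (hd : 1 ≤ d) {a : ℝ} (ha : 0 ≤ a) : (a ^ (1 / (d : ℝ))) ^ d = a := by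
  rw [one_div, Real.rpow_inv_natCast_pow ha (by omega)]

/-- Pointwise bound for the number of lattice points that a dilation can move to `x`. -/
lemma tsum_indicator_dilation_le (hd : 1 ≤ d) {B : Matrix (Fin d) (Fin d) ℝ}
    (hB : IsFrolovMatrix B) {n : ℕ} (hn : 1 ≤ n) (x : Fin d → ℝ) (y : ℝ≥0∞) :
    ∑' k : {k : Fin d → ℤ // k ≠ 0},
      ENNReal.ofReal (∏ i, |(n : ℝ) ^ (1 / (d : ℝ)) * latticePoint B k.1 i|)⁻¹ *
        (Set.indicator {k : Fin d → ℤ | (fun i => x i / ((n : ℝ) ^ (1 / (d : ℝ)) *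
          latticePoint B k i)) ∈ Set.Icc (fun _ => 1) (fun _ => (2 : ℝ) ^ (1 / (d : ℝ)))}
          (fun _ => y) k.1)
      ≤ ENNReal.ofReal (4 / n) * Set.indicator {x | (n : ℝ) ≤ ∏ i, |x i|} (fun _ => y) x := by
  set s : ℝ := (n : ℝ) ^ (1 / (d : ℝ)) with hs
  set t : ℝ := (2 : ℝ) ^ (1 / (d : ℝ)) with ht
  have hn0 : (0 : ℝ) < n := by exact_mod_cast hn
  have hs0 : 0 < s := Real.rpow_pos_of_pos hn0 _
  have ht1 : 1 ≤ t := Real.one_le_rpow (by norm_num) (by positivity)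
  have ht0 : 0 < t := by linarith
  have hsd : s ^ d = n := rpow_inv_pow hd hn0.le
  have htd : t ^ d = 2 := rpow_inv_pow hd (by norm_num)
  set K : Set (Fin d → ℤ) := {k | (fun i => x i / (s * latticePoint B k i)) ∈
    Set.Icc (fun _ => 1) (fun _ => t)} with hK
  set p : ℝ := ∏ i, |x i| with hp
  have hprod : ∀ k : Fin d → ℤ, ∏ i, |s * latticePoint B k i|
      = n * |∏ i, latticePoint B k i| := by
    intro k
    simp only [abs_mul, Finset.prod_mul_distrib, abs_of_pos hs0, Finset.prod_const,
      Finset.card_univ, Fintype.card_fin, hsd, Finset.abs_prod]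
  have hprod_ge : ∀ k : Fin d → ℤ, k ≠ 0 → (n : ℝ) ≤ ∏ i, |s * latticePoint B k i| := by
    intro k hk
    rw [hprod]
    exact le_mul_of_one_le_right hn0.le (hB.one_le_prod k hk)
  -- Since x / 0 = 0 < 1, membership in K itself excludes a zero denominator.
  have hw0 : ∀ k ∈ K, ∀ i, s * latticePoint B k i ≠ 0 := by
    intro k hk i h0
    have := hk.1 i
    simp only [h0, div_zero] at this
    linarith
  have hKabs : ∀ k ∈ K, ∀ i, |x i| = x i / (s * latticePoint B k i) * |s * latticePoint B k i| := by
    intro k hk i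
    have h1 : 0 ≤ x i / (s * latticePoint B k i) := zero_le_one.trans (hk.1 i)
    rw [← abs_of_nonneg h1, ← abs_mul, div_mul_cancel₀ _ (hw0 k hk i)]
  have hKge : ∀ k ∈ K, ∏ i, |s * latticePoint B k i| ≤ p := by
    intro k hk
    refine Finset.prod_le_prod (fun i _ => abs_nonneg _) fun i _ => ?_
    rw [hKabs k hk i]
    exact le_mul_of_one_le_left (abs_nonneg _) (hk.1 i)
  have hKle : ∀ k ∈ K, p ≤ 2 * ∏ i, |s * latticePoint B k i| := by
    intro k hk
    have : ∏ i, (t * |s * latticePoint B k i|) = 2 * ∏ i, |s * latticePoint B k i| := by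
      rw [Finset.prod_mul_distrib]
      simp [htd]
    rw [← this]
    refine Finset.prod_le_prod (fun i _ => abs_nonneg _) fun i _ => ?_
    rw [hKabs k hk i]
    exact mul_le_mul_of_nonneg_right (hk.2 i) (abs_nonneg _)
  by_cases hpn : (n : ℝ) ≤ p
  · have hp0 : 0 < p := hn0.trans_le hpn
    rw [Set.indicator_of_mem (show x ∈ {x : Fin d → ℝ | (n : ℝ) ≤ ∏ i, |x i|} from hpn)]
    have hcard : ∑' k : {k : Fin d → ℤ // k ≠ 0}, Set.indicator K (fun _ => (1 : ℝ≥0∞)) k.1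
        ≤ ENNReal.ofReal (2 * p / n) := by
      -- With s = n^{1/d} and t = 2^{1/d}, the relation x_i = s (Bk)_i u_i with 1 ≤ u_i ≤ t puts
      -- (Bk)_i between x_i/(st) and x_i/s, so condition (c) counts the k in K.
      set a : Fin d → ℝ := fun i => x i / s with ha
      set b : Fin d → ℝ := fun i => x i / s / t with hb
      obtain ⟨hfin, hcard⟩ := hB.card_le a b
      set K' : Set (Fin d → ℤ) := {m | latticePoint B m ∈ Set.uIcc a b} with hK'
      have hsub : K ⊆ K' := by
        intro k hk
        have hmem : ∀ i, latticePoint B k i ∈ Set.uIcc (a i) (b i) := by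
          intro i
          set l := latticePoint B k i with hl
          set q := x i / (s * l) with hq
          have hq1 : 1 ≤ q := hk.1 i
          have hq2 : q / t ≤ 1 := (div_le_one ht0).mpr (hk.2 i)
          have hsl : s * l ≠ 0 := hw0 k hk i
          have hai : a i = q * l := by
            simp only [ha, hq]
            have : l ≠ 0 := right_ne_zero_of_mul hsl
            field_simp
          have hbi : b i = q / t * l := by
            have : b i = a i / t := rfl
            rw [this, hai]; ring
          rw [hai, hbi, Set.mem_uIcc]
          rcases le_total 0 l with h0 | h0
          · exact Or.inr ⟨by nlinarith, by nlinarith⟩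
          · exact Or.inl ⟨by nlinarith, by nlinarith⟩
        exact ⟨fun i => (hmem i).1, fun i => (hmem i).2⟩
      have hle : ∑' k : {k : Fin d → ℤ // k ≠ 0}, Set.indicator K (fun _ => (1 : ℝ≥0∞)) k.1
          ≤ ∑' k : Fin d → ℤ, Set.indicator K' (fun _ => (1 : ℝ≥0∞)) k := by
        refine (ENNReal.tsum_le_tsum fun k => ?_).trans
          (ENNReal.tsum_comp_le_tsum_of_injective Subtype.val_injective _)
        exact Set.indicator_le_indicator_of_subset hsub (fun _ => zero_le_one) _
      refine hle.trans ?_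
      rw [← tsum_subtype, ENNReal.tsum_set_one, ← hfin.cast_ncard_eq, ENat.toENNReal_coe,
        ← ENNReal.ofReal_natCast]
      refine ENNReal.ofReal_le_ofReal (hcard.trans ?_)
      have hab : ∏ i, |a i - b i| ≤ p / n := by
        have : p / n = ∏ i, (|x i| / s) := by
          rw [Finset.prod_div_distrib]; simp [hsd, hp]
        rw [this]
        refine Finset.prod_le_prod (fun i _ => abs_nonneg _) fun i _ => ?_
        have h1 : a i - b i = x i / s * (1 - t⁻¹) := by simp only [ha, hb]; ring
        have h2 : 0 ≤ 1 - t⁻¹ := sub_nonneg.mpr (inv_le_one_of_one_le₀ ht1)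
        rw [h1, abs_mul, abs_of_nonneg h2, abs_div, abs_of_pos hs0]
        exact mul_le_of_le_one_right (by positivity) (by linarith [inv_pos.mpr ht0])
      -- Here p ≥ n absorbs the additive 1 of condition (c).
      have h1 : 1 ≤ p / n := (one_le_div hn0).mpr hpn
      have h2 : 2 * p / n = p / n + p / n := by ring
      linarith
    calc _ ≤ ∑' k : {k : Fin d → ℤ // k ≠ 0},
          (ENNReal.ofReal (2 / p) * y) * Set.indicator K (fun _ => (1 : ℝ≥0∞)) k.1 := by
          refine ENNReal.tsum_le_tsum fun k => ?_
          by_cases hk : k.1 ∈ K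
          · rw [Set.indicator_of_mem hk, Set.indicator_of_mem hk, mul_one]
            refine mul_le_mul_left (ENNReal.ofReal_le_ofReal ?_) y
            have hpos : 0 < ∏ i, |s * latticePoint B k.1 i| := hn0.trans_le (hprod_ge _ k.2)
            rw [inv_eq_one_div, div_le_div_iff₀ hpos hp0]
            linarith [hKle _ hk]
          · rw [Set.indicator_of_notMem hk]; simp
      _ ≤ (ENNReal.ofReal (2 / p) * y) * ENNReal.ofReal (2 * p / n) := by
          rw [ENNReal.tsum_mul_left]
          exact mul_le_mul_right hcard _
      _ = ENNReal.ofReal (4 / n) * y := by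
          rw [mul_right_comm, ← ENNReal.ofReal_mul (by positivity)]
          congr 2
          field_simp
          norm_num
  · have hz : ∀ k : {k : Fin d → ℤ // k ≠ 0}, k.1 ∉ K := fun k hk =>
      hpn ((hprod_ge _ k.2).trans (hKge _ hk))
    simp [Set.indicator_of_notMem (hz _)]

lemma dilated_mulVec_intVec (n : ℕ) (B : Matrix (Fin d) (Fin d) ℝ) (u : Fin d → ℝ)
    (k : Fin d → ℤ) : dilated n u B *ᵥ intVec k
      = fun i => (n : ℝ) ^ (1 / (d : ℝ)) * latticePoint B k i * u i := by
  have h : B *ᵥ intVec k = latticePoint B k := rfl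
  ext i
  rw [dilated, Matrix.smul_mulVec, ← Matrix.mulVec_mulVec, h]
  simp only [Pi.smul_apply, Matrix.mulVec_diagonal, smul_eq_mul]
  ring

/-- Averaging over random dilations of the lattice. -/
theorem lintegral_tsum_dilated_le (hd : 1 ≤ d) {B : Matrix (Fin d) (Fin d) ℝ}
    (hB : IsFrolovMatrix B) {n : ℕ} (hn : 1 ≤ n) {F : (Fin d → ℝ) → ℝ≥0∞} (hF : Measurable F) :
    ∫⁻ u in Set.Icc (fun _ => 1) (fun _ => (2 : ℝ) ^ (1 / (d : ℝ))),
      ∑' k : {k : Fin d → ℤ // k ≠ 0}, F (dilated n u B *ᵥ intVec k.1)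
      ≤ ENNReal.ofReal (4 / n) * ∫⁻ x in {x | (n : ℝ) ≤ ∏ i, |x i|}, F x := by
  set s : ℝ := (n : ℝ) ^ (1 / (d : ℝ)) with hs
  set D : Set (Fin d → ℝ) := Set.Icc (fun _ => 1) (fun _ => (2 : ℝ) ^ (1 / (d : ℝ))) with hD
  have hn0 : (0 : ℝ) < n := by exact_mod_cast hn
  have hs0 : 0 < s := Real.rpow_pos_of_pos hn0 _
  have hmul := dilated_mulVec_intVec n B
  have hne : ∀ k : {k : Fin d → ℤ // k ≠ 0}, ∀ i, s * latticePoint B k.1 i ≠ 0 := by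
    intro k i
    refine mul_ne_zero hs0.ne' fun h0 => ?_
    have := hB.one_le_prod k.1 k.2
    rw [Finset.prod_eq_zero (Finset.mem_univ i) h0, abs_zero] at this
    linarith
  have hDm : MeasurableSet D := measurableSet_Icc
  have hSm : MeasurableSet {x : Fin d → ℝ | (n : ℝ) ≤ ∏ i, |x i|} :=
    measurableSet_le measurable_const (by fun_prop)
  simp only [hmul, ← hs]
  have hterm : ∀ k : {k : Fin d → ℤ // k ≠ 0},
      Measurable fun u : Fin d → ℝ => F fun i => s * latticePoint B k.1 i * u i := fun k =>
    hF.comp (by fun_prop)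
  have hE : ∀ k : Fin d → ℤ,
      MeasurableSet {x : Fin d → ℝ | (fun i => x i / (s * latticePoint B k i)) ∈ D} := fun k =>
    (show Measurable fun (x : Fin d → ℝ) i => x i / (s * latticePoint B k i) by fun_prop) hDm
  rw [lintegral_tsum fun k => (hterm k).aemeasurable]
  have h1 : ∀ k : {k : Fin d → ℤ // k ≠ 0},
      ∫⁻ u in D, F (fun i => s * latticePoint B k.1 i * u i)
      = ∫⁻ x, ENNReal.ofReal (∏ i, |s * latticePoint B k.1 i|)⁻¹ *
        {x : Fin d → ℝ | (fun i => x i / (s * latticePoint B k.1 i)) ∈ D}.indicator F x := by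
    intro k
    rw [lintegral_const_mul _ (hF.indicator (hE k.1)),
      ← lintegral_diagonal_mulVec (hne k) (hF.indicator (hE k.1)), ← lintegral_indicator hDm]
    refine lintegral_congr fun u => ?_
    have hu : (fun i => s * latticePoint B k.1 i * u i / (s * latticePoint B k.1 i)) = u := by
      ext i
      rw [mul_div_cancel_left₀ _ (hne k i)]
    by_cases huD : u ∈ D
    · rw [Set.indicator_of_mem huD, Set.indicator_of_mem (by rwa [Set.mem_ofPred_eq, hu])]
    · rw [Set.indicator_of_notMem huD, Set.indicator_of_notMem (by rwa [Set.mem_ofPred_eq, hu])]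
  have hG : ∀ k : {k : Fin d → ℤ // k ≠ 0}, Measurable fun x =>
      ENNReal.ofReal (∏ i, |s * latticePoint B k.1 i|)⁻¹ *
        {x : Fin d → ℝ | (fun i => x i / (s * latticePoint B k.1 i)) ∈ D}.indicator F x := fun k =>
    (hF.indicator (hE k.1)).const_mul _
  have h2 := lintegral_tsum (μ := volume) fun k => (hG k).aemeasurable
  rw [tsum_congr h1, ← h2, ← lintegral_indicator hSm]
  have h3 := lintegral_const_mul (μ := volume) (ENNReal.ofReal (4 / n)) (hF.indicator hSm)
  refine le_of_le_of_eq (lintegral_mono fun x => ?_) h3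
  exact tsum_indicator_dilation_le hd hB hn x (F x)

end Average

/-! ### The mean square error of the randomized rule -/

section RandomError

variable {d : ℕ}

/-- Writing the inverse as adjugate over determinant, with 0⁻¹ = 0, gives measurability at singular
matrices too. -/
lemma measurable_quadRule_dilated (n : ℕ) (B : Matrix (Fin d) (Fin d) ℝ) {f : (Fin d → ℝ) → ℝ}
    (hf : Continuous f) :
    Measurable fun p : (Fin d → ℝ) × (Fin d → ℝ) => quadRule (dilated n p.1 B) p.2 f := by
  have hS : Continuous fun p : (Fin d → ℝ) × (Fin d → ℝ) => dilated n p.1 B := by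
    unfold dilated
    fun_prop
  have hinv : ∀ i j, Measurable fun p : (Fin d → ℝ) × (Fin d → ℝ) => (dilated n p.1 B)⁻¹ i j := by
    intro i j
    simp only [Matrix.inv_def, Ring.inverse_eq_inv', Matrix.smul_apply, smul_eq_mul]
    exact hS.matrix_det.measurable.inv.mul (hS.matrix_adjugate.matrix_elem i j).measurable
  refine hS.matrix_det.abs.measurable.inv.mul (Measurable.tsum fun m => hf.measurable.comp ?_)
  refine measurable_pi_lambda _ fun i => ?_
  simp only [Matrix.mulVec, dotProduct, Matrix.transpose_apply]
  exact Finset.measurable_fun_sum _ fun j _ => (hinv j i).mul (by fun_prop)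

lemma isUnit_dilated {n : ℕ} (hn : 1 ≤ n) {B : Matrix (Fin d) (Fin d) ℝ} (hB : IsUnit B)
    {u : Fin d → ℝ} (hu : ∀ i, u i ≠ 0) : IsUnit (dilated n u B) := by
  rw [Matrix.isUnit_iff_isUnit_det, isUnit_iff_ne_zero] at hB ⊢
  have hn0 : (0 : ℝ) < n := by exact_mod_cast hn
  rw [dilated, Matrix.det_smul, Matrix.det_mul, Matrix.det_diagonal]
  exact mul_ne_zero (pow_ne_zero _ (Real.rpow_pos_of_pos hn0 _).ne')
    (mul_ne_zero (Finset.prod_ne_zero_iff.mpr fun i _ => hu i) hB)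

/-- Decay of the Fourier transform of functions of dominating mixed smoothness, in mean square
outside a hyperbolic cross. -/
theorem lintegral_fourierInt_hyperbolic_le {r n : ℕ} (hn : 1 ≤ n) {f : (Fin d → ℝ) → ℝ}
    (hf : MemHMixCube r f) :
    ∫⁻ x in {x | (n : ℝ) ≤ ∏ i, |x i|}, ‖fourierInt f x‖ₑ ^ 2
      ≤ ENNReal.ofReal (((n : ℝ) ^ (2 * r))⁻¹ * cubeNorm r f ^ 2) := by
  obtain ⟨hfc, hfs, -, hder⟩ := hf
  obtain ⟨g, hfg, hg⟩ := hder (fun _ => r) fun _ => le_rfl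
  rw [Measure.restrict_univ] at hg
  have hn0 : (0 : ℝ) < n := by exact_mod_cast hn
  have hfi : Integrable f := hfc.integrable_of_hasCompactSupport
    (isCompact_Icc.of_isClosed_subset (isClosed_tsupport f) hfs)
  have hg0 := hfg.ae_eq_zero_of_notMem isClosed_Icc hfs
  have hgi : Integrable g := IntegrableOn.integrable_of_ae_notMem_eq_zero
    ((hg.restrict (Set.Icc 0 1)).integrable (by norm_num)) hg0
  have hpt : ∀ x : Fin d → ℝ, (n : ℝ) ≤ ∏ i, |x i| →
      ‖fourierInt f x‖ₑ ^ 2 ≤ ENNReal.ofReal ((n : ℝ) ^ (2 * r))⁻¹ * ‖fourierInt g x‖ₑ ^ 2 := by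
    intro x hx
    rw [← ofReal_norm, ← ofReal_norm, ← ENNReal.ofReal_pow (norm_nonneg _),
      ← ENNReal.ofReal_pow (norm_nonneg _), ← ENNReal.ofReal_mul (by positivity)]
    refine ENNReal.ofReal_le_ofReal ?_
    -- The factors 2π ≥ 1 are dropped, leaving (∏|x_i|)^r ≥ n^r.
    have h1 : (n : ℝ) ^ r * ‖fourierInt f x‖ ≤ ‖fourierInt g x‖ := by
      rw [norm_fourierInt_of_isWeakDeriv hfi hfs hgi hg0 hfg]
      refine mul_le_mul_of_nonneg_right ?_ (norm_nonneg _)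
      rw [Finset.prod_pow]
      refine pow_le_pow_left₀ hn0.le (hx.trans ?_) r
      refine Finset.prod_le_prod (fun i _ => abs_nonneg _) fun i _ => ?_
      exact le_mul_of_one_le_left (abs_nonneg _) (by linarith [Real.pi_gt_three])
    rw [inv_mul_eq_div, le_div_iff₀ (by positivity)]
    calc ‖fourierInt f x‖ ^ 2 * (n : ℝ) ^ (2 * r) = ((n : ℝ) ^ r * ‖fourierInt f x‖) ^ 2 := by ring
      _ ≤ ‖fourierInt g x‖ ^ 2 := pow_le_pow_left₀ (by positivity) h1 2
  have hSm : MeasurableSet {x : Fin d → ℝ | (n : ℝ) ≤ ∏ i, |x i|} :=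
    measurableSet_le measurable_const (by fun_prop)
  calc _ ≤ ∫⁻ x in {x | (n : ℝ) ≤ ∏ i, |x i|},
        ENNReal.ofReal ((n : ℝ) ^ (2 * r))⁻¹ * ‖fourierInt g x‖ₑ ^ 2 :=
        setLIntegral_mono' hSm hpt
    _ ≤ ∫⁻ x, ENNReal.ofReal ((n : ℝ) ^ (2 * r))⁻¹ * ‖fourierInt g x‖ₑ ^ 2 :=
        setLIntegral_le_lintegral _ _
    _ = ENNReal.ofReal ((n : ℝ) ^ (2 * r))⁻¹ * ∫⁻ x in Set.Icc 0 1, ‖g x‖ₑ ^ 2 := by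
        rw [lintegral_const_mul' _ _ ENNReal.ofReal_ne_top, plancherel_cube hg hg0]
    _ ≤ _ := by
        rw [ENNReal.ofReal_mul (by positivity)]
        exact mul_le_mul_right (lintegral_sq_le_cubeNorm hg hfg) _

/-- The dilation box `[1, 2^{1/d}]^d`. -/
abbrev dilationBox (d : ℕ) : Set (Fin d → ℝ) :=
  Set.Icc (fun _ => 1) (fun _ => (2 : ℝ) ^ (1 / (d : ℝ)))

lemma one_lt_two_rpow (hd : 1 ≤ d) : (1 : ℝ) < 2 ^ (1 / (d : ℝ)) :=
  Real.one_lt_rpow one_lt_two (by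
    have : (0 : ℝ) < d := by exact_mod_cast hd
    positivity)

lemma volume_dilationBox (hd : 1 ≤ d) :
    volume (dilationBox d) = ENNReal.ofReal (((2 : ℝ) ^ (1 / (d : ℝ)) - 1) ^ d) := by
  rw [Real.volume_Icc_pi]
  simp only [Finset.prod_const, Finset.card_univ, Fintype.card_fin]
  rw [ENNReal.ofReal_pow (by linarith [one_lt_two_rpow hd])]

lemma cond_volume_cube (d : ℕ) :
    (volume : Measure (Fin d → ℝ))[|Set.Icc (fun _ => 0) (fun _ => 1)]
      = volume.restrict (Set.Icc 0 1) := by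
  have : (volume : Measure (Fin d → ℝ)) (Set.Icc (fun _ => 0) (fun _ => 1)) = 1 := by
    simp [Real.volume_Icc_pi]
  rw [ProbabilityTheory.cond, this, inv_one, one_smul]
  rfl

/-- The mean square error of the randomized rule. -/
theorem lintegral_randomError_le {r n : ℕ} (hd : 1 ≤ d) (hn : 1 ≤ n)
    {B : Matrix (Fin d) (Fin d) ℝ} (hB : IsFrolovMatrix B) {f : (Fin d → ℝ) → ℝ}
    (hf : MemHMixCube r f) :
    ∫⁻ p, ‖quadRule (dilated n p.1 B) p.2 f - ∫ x, f x‖ₑ ^ 2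
      ∂((volume[|dilationBox d]).prod (volume.restrict (Set.Icc (0 : Fin d → ℝ) 1)))
      ≤ ENNReal.ofReal (4 / ((2 : ℝ) ^ (1 / (d : ℝ)) - 1) ^ d *
        ((n : ℝ)⁻¹ * ((n : ℝ) ^ (2 * r))⁻¹) * cubeNorm r f ^ 2) := by
  have hn0 : (0 : ℝ) < n := by exact_mod_cast hn
  have ht := one_lt_two_rpow hd
  have ht0 : 0 < ((2 : ℝ) ^ (1 / (d : ℝ)) - 1) ^ d := pow_pos (by linarith) d
  have hfc : HasCompactSupport f :=
    isCompact_Icc.of_isClosed_subset (isClosed_tsupport f) hf.2.1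
  have hfi : Integrable f := hf.1.integrable_of_hasCompactSupport hfc
  refine (lintegral_prod_le _).trans ?_
  -- Normalising the uniform law divides by the volume (2^{1/d} - 1)^d of the dilation box.
  rw [ProbabilityTheory.cond, lintegral_smul_measure]
  have h1 : ∫⁻ u in dilationBox d, ∫⁻ v in Set.Icc 0 1,
      ‖quadRule (dilated n u B) v f - ∫ x, f x‖ₑ ^ 2
      ≤ ∫⁻ u in dilationBox d, ∑' k : {k : Fin d → ℤ // k ≠ 0},
        ‖fourierInt f (dilated n u B *ᵥ intVec k.1)‖ₑ ^ 2 := by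
    refine setLIntegral_mono' measurableSet_Icc fun u hu => ?_
    refine lintegral_quadRule_sub_sq_le (isUnit_dilated hn hB.isUnit fun i => ?_) hf.1 hfc
    have := hu.1 i
    simp only at this
    linarith
  have h2 := lintegral_tsum_dilated_le hd hB hn
    ((continuous_fourierInt hfi).measurable.enorm.pow_const 2)
  have h3 := h1.trans (h2.trans
    (mul_le_mul_right (lintegral_fourierInt_hyperbolic_le hn hf) (ENNReal.ofReal (4 / n))))
  rw [volume_dilationBox hd, ← ENNReal.ofReal_inv_of_pos ht0, smul_eq_mul]
  refine (mul_le_mul_right h3 _).trans (le_of_eq ?_)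
  rw [← ENNReal.ofReal_mul (by positivity), ← ENNReal.ofReal_mul (by positivity)]
  congr 1
  ring

end RandomError

end

end FrolovMix

/-! ### The error bound -/

theorem mainTheorem2 (d r : ℕ) (hd : 1 ≤ d) (hr : 1 ≤ r)
    (B : Matrix (Fin d) (Fin d) ℝ) (hB : FrolovMix.IsFrolovMatrix B) :
    ∃ c : ℝ, 0 < c ∧
      ∀ {Ω : Type*} [MeasurableSpace Ω] (P : Measure Ω) [IsProbabilityMeasure P]
        (U V : Ω → Fin d → ℝ),
        pdf.IsUniform U (Set.Icc (fun _ => 1) (fun _ => (2 : ℝ) ^ (1 / (d : ℝ)))) P volume →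
        pdf.IsUniform V (Set.Icc (fun _ => 0) (fun _ => 1)) P volume →
        IndepFun U V P →
        ∀ n : ℕ, 2 ≤ n → ∀ f : (Fin d → ℝ) → ℝ, FrolovMix.MemHMixCube r f →
          MemLp (fun ω => FrolovMix.quadRule (FrolovMix.dilated n (U ω) B) (V ω) f - ∫ x, f x)
            2 P ∧
          (∫ ω, |FrolovMix.quadRule (FrolovMix.dilated n (U ω) B) (V ω) f - ∫ x, f x| ^ 2 ∂P)
              ^ (1 / 2 : ℝ)
            ≤ c * (n : ℝ) ^ (-(r : ℝ) - 1 / 2) * FrolovMix.cubeNorm r f := by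
  have ht := FrolovMix.one_lt_two_rpow hd
  have ht0 : 0 < ((2 : ℝ) ^ (1 / (d : ℝ)) - 1) ^ d := pow_pos (by linarith) d
  refine ⟨Real.sqrt (4 / ((2 : ℝ) ^ (1 / (d : ℝ)) - 1) ^ d),
    Real.sqrt_pos.mpr (by positivity), ?_⟩
  intro Ω _ P _ U V hU hV hUV n hn f hf
  have hn0 : (0 : ℝ) < n := by exact_mod_cast (by omega : 0 < n)
  have hvol := FrolovMix.volume_dilationBox hd
  -- A non-measurable map has push-forward 0 by convention, so a uniform law on a set of positive
  -- finite volume forces measurability.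
  have hUm : AEMeasurable U P := hU.aemeasurable
    (by rw [hvol]; exact (ENNReal.ofReal_pos.mpr ht0).ne')
    (by rw [hvol]; exact ENNReal.ofReal_ne_top)
  have hVm : AEMeasurable V P := hV.aemeasurable
    (by simp [Real.volume_Icc_pi]) (by simp [Real.volume_Icc_pi])
  have hlaw := (indepFun_iff_map_prod_eq_prod_map_map hUm hVm).mp hUV
  rw [hU, hV, FrolovMix.cond_volume_cube] at hlaw
  have hE : Measurable fun p : (Fin d → ℝ) × (Fin d → ℝ) =>
      FrolovMix.quadRule (FrolovMix.dilated n p.1 B) p.2 f - ∫ x, f x :=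
    (FrolovMix.measurable_quadRule_dilated n B hf.1).sub measurable_const
  set X : Ω → ℝ := fun ω =>
    FrolovMix.quadRule (FrolovMix.dilated n (U ω) B) (V ω) f - ∫ x, f x with hX
  have hXm : AEStronglyMeasurable X P :=
    (hE.comp_aemeasurable (hUm.prodMk hVm)).aestronglyMeasurable
  set b : ℝ := 4 / ((2 : ℝ) ^ (1 / (d : ℝ)) - 1) ^ d * ((n : ℝ)⁻¹ * ((n : ℝ) ^ (2 * r))⁻¹) *
    FrolovMix.cubeNorm r f ^ 2 with hb
  have hb0 : 0 ≤ b := by positivity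
  have hle : ∫⁻ ω, ‖X ω‖ₑ ^ 2 ∂P ≤ ENNReal.ofReal b := by
    have h := FrolovMix.lintegral_randomError_le hd (by omega : 1 ≤ n) hB hf
    rw [← hlaw, lintegral_map' (hE.enorm.pow_const 2).aemeasurable (hUm.prodMk hVm)] at h
    exact h
  refine ⟨⟨hXm, ?_⟩, ?_⟩
  · rw [eLpNorm_lt_top_iff_lintegral_rpow_enorm_lt_top (by norm_num) (by norm_num)]
    simp only [ENNReal.toReal_ofNat, ENNReal.rpow_ofNat]
    exact hle.trans_lt ENNReal.ofReal_lt_top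
  · have hint : ∫ ω, |X ω| ^ 2 ∂P ≤ b := by
      have hm : AEStronglyMeasurable (fun ω => |X ω| ^ 2) P := hXm.norm.pow 2
      rw [integral_eq_lintegral_of_nonneg_ae
        (Filter.Eventually.of_forall fun ω => sq_nonneg |X ω|) hm]
      refine ENNReal.toReal_le_of_le_ofReal hb0 ?_
      refine le_of_eq_of_le (lintegral_congr fun ω => ?_) hle
      rw [← ofReal_norm, Real.norm_eq_abs, ENNReal.ofReal_pow (abs_nonneg _)]
    have hN : 0 ≤ FrolovMix.cubeNorm r f := Real.sqrt_nonneg _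
    rw [← Real.sqrt_eq_rpow]
    refine Real.sqrt_le_iff.mpr ⟨by positivity, hint.trans (le_of_eq ?_)⟩
    have hpow : ((n : ℝ) ^ (-(r : ℝ) - 1 / 2)) ^ 2 = (n : ℝ)⁻¹ * ((n : ℝ) ^ (2 * r))⁻¹ := by
      rw [← Real.rpow_natCast, ← Real.rpow_mul hn0.le, ← Real.rpow_natCast (n : ℝ) (2 * r),
        ← Real.rpow_neg hn0.le, ← Real.rpow_neg_one, ← Real.rpow_add hn0]
      congr 1
      push_cast
      ring
    rw [mul_pow, mul_pow, hpow, Real.sq_sqrt (by positivity)]
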